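/- Let $(M,d)$ be a metric space with a base point $c\in M$, and let $\mathrm{Lip}_0(M)$ be the real Banach space of Lipschitz functions $g:M\to\mathbb R$ with $g(c)=0$, normed by the best Lipschitz constant $\mathrm{Lip}(g)=\sup_{x\ne y}|g(x)-g(y)|/d(x,y)$. For $x\in M$ let $\delta(x)\in\mathrm{Lip}_0(M)^*$ be the evaluation functional $g\mapsto g(x)$. The Lipschitz-free space over $M$ is $\mathcal F(M)=\overline{\mathrm{span}}^{\|\cdot\|}\{\delta(x):x\in M\}\subset \mathrm{Lip}_0(M)^*$. For a Lipschitz map $f:M\to M$ with $f(c)=c$, let $\widehat f:\mathcal F(M)\to\mathcal F(M)$ be the unique bounded linear operator with $\widehat f(\delta(x))=\delta(f(x))$ for all $x\in M$. A map $T:X\to X$ of a topological space is topologically transitive if for all nonempty open $U,V\subset X$ there is $n\ge 0$ with $T^n(U)\cap V\neq\emptyset$; it is weakly mixing if $T\times T$ is topologically transitive on $X\times X$; it is mixing if for all nonempty open $U,V\subset X$ there is $N\ge 0$ with $T^n(U)\cap V\ne\emptyset$ for all $n\ge N$. **Theorem.** Let $a<b$ be real numbers, let $f:[a,b]\to[a,b]$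 be Lipschitz and topologically transitive, and let $c\in[a,b]$ be a fixed point of $f$, taken as the base point of $[a,b]$. Then $\widehat f:\mathcal F([a,b])\to\mathcal F([a,b])$ is weakly mixing. If moreover $f$ has at least two fixed points, then $\widehat f$ is mixing. -/

import Mathlib

open scoped NNReal

/-! ### Dynamical notions for a self-map of a topological space -/

section Dynamics

variable {X : Type*} [TopologicalSpace X]

/-- `f` is topologically transitive: for all nonempty open `U`, `V` there is `n ≥ 0` with
`f^n(U) ∩ V ≠ ∅`. -/
def IsTransitiveMap (f : X → X) : Prop :=
  ∀ U V : Set X, IsOpen U → U.Nonempty → IsOpen V → V.Nonempty →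
    ∃ n : ℕ, (f^[n] '' U ∩ V).Nonempty

/-- `f` is topologically mixing: for all nonempty open `U`, `V` there is `N` such that
`f^n(U) ∩ V ≠ ∅` for every `n ≥ N`. -/
def IsMixingMap (f : X → X) : Prop :=
  ∀ U V : Set X, IsOpen U → U.Nonempty → IsOpen V → V.Nonempty →
    ∃ N : ℕ, ∀ n : ℕ, N ≤ n → (f^[n] '' U ∩ V).Nonempty

/-- `f` is topologically weakly mixing: `f × f` is topologically transitive on `X × X`. -/
def IsWeaklyMixingMap (f : X → X) : Prop :=
  IsTransitiveMap (Prod.map f f)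

end Dynamics

/-! ### The space of Lipschitz functions vanishing at the base point -/

section LipZero

variable {M : Type*} [MetricSpace M]

/-- The real vector space of Lipschitz functions `M → ℝ` vanishing at the base point `c`. -/
def lipZeroSubmodule (c : M) : Submodule ℝ (M → ℝ) where
  carrier := {g | g c = 0 ∧ ∃ K : ℝ≥0, LipschitzWith K g}
  zero_mem' := ⟨rfl, 0, LipschitzWith.const 0⟩
  add_mem' := by
    rintro g h ⟨hg, K, hK⟩ ⟨hh, L, hL⟩
    exact ⟨by simp [hg, hh], K + L, hK.add hL⟩
  smul_mem' := by
    rintro r g ⟨hg, K, hK⟩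
    refine ⟨by simp [hg], ‖r‖₊ * K, ?_⟩
    refine LipschitzWith.of_dist_le_mul fun x y => ?_
    have h := hK.dist_le_mul x y
    simp only [Pi.smul_apply, dist_smul₀, NNReal.coe_mul, coe_nnnorm, mul_assoc]
    exact mul_le_mul_of_nonneg_left h (norm_nonneg r)

/-- `Lip₀(M)`, as a type of its own: its topology is the one of the norm below, not the one of
pointwise convergence. -/
def LipZero (c : M) : Type _ := lipZeroSubmodule c

namespace LipZero

variable {c : M}

noncomputable instance : AddCommGroup (LipZero c) :=
  inferInstanceAs (AddCommGroup (lipZeroSubmodule c))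

noncomputable instance : Module ℝ (LipZero c) :=
  inferInstanceAs (Module ℝ (lipZeroSubmodule c))

instance : FunLike (LipZero c) M ℝ where
  coe g := g.1
  coe_injective := Subtype.val_injective

theorem apply_base (g : LipZero c) : g c = 0 := g.2.1

theorem exists_lipschitzWith (g : LipZero c) : ∃ K : ℝ≥0, LipschitzWith K g := g.2.2

@[simp] theorem add_apply (g h : LipZero c) (x : M) : (g + h) x = g x + h x := rfl

@[simp] theorem smul_apply (r : ℝ) (g : LipZero c) (x : M) : (r • g) x = r * g x := rfl

@[simp] theorem zero_apply (x : M) : (0 : LipZero c) x = 0 := rfl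

/-- The norm of `Lip₀(M)` is the best Lipschitz constant
`Lip(g) = sup_{x ≠ y} |g(x) - g(y)| / d(x, y)`; the pairs with `x = y` contribute `0 / 0 = 0`. -/
noncomputable instance : Norm (LipZero c) where
  norm g := ⨆ p : M × M, |g p.1 - g p.2| / dist p.1 p.2

theorem norm_def (g : LipZero c) : ‖g‖ = ⨆ p : M × M, |g p.1 - g p.2| / dist p.1 p.2 := rfl

theorem quotient_le_of_lipschitzWith {g : M → ℝ} {K : ℝ≥0} (hK : LipschitzWith K g) (x y : M) :
    |g x - g y| / dist x y ≤ K := by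
  refine div_le_of_le_mul₀ dist_nonneg K.2 ?_
  simpa [Real.dist_eq] using hK.dist_le_mul x y

theorem bddAbove_quotients (g : LipZero c) :
    BddAbove (Set.range fun p : M × M => |g p.1 - g p.2| / dist p.1 p.2) := by
  obtain ⟨K, hK⟩ := g.exists_lipschitzWith
  exact ⟨K, by rintro _ ⟨p, rfl⟩; exact quotient_le_of_lipschitzWith hK p.1 p.2⟩

theorem abs_sub_le (g : LipZero c) (x y : M) : |g x - g y| ≤ ‖g‖ * dist x y := by
  rcases eq_or_ne x y with rfl | hxy
  · simp
  · rw [← div_le_iff₀ (dist_pos.2 hxy)]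
    exact le_ciSup g.bddAbove_quotients (x, y)

theorem norm_le_of_forall {g : LipZero c} {K : ℝ} (hK : 0 ≤ K)
    (h : ∀ x y, |g x - g y| ≤ K * dist x y) : ‖g‖ ≤ K := by
  have : Nonempty (M × M) := ⟨(c, c)⟩
  exact ciSup_le fun p => div_le_of_le_mul₀ dist_nonneg hK (h p.1 p.2)

theorem norm_nonneg' (g : LipZero c) : 0 ≤ ‖g‖ :=
  Real.iSup_nonneg fun _ => div_nonneg (abs_nonneg _) dist_nonneg

theorem abs_apply_le (g : LipZero c) (x : M) : |g x| ≤ dist x c * ‖g‖ := by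
  simpa [g.apply_base, mul_comm] using g.abs_sub_le x c

theorem normedSpaceCore : NormedSpace.Core ℝ (LipZero c) where
  norm_nonneg := norm_nonneg'
  norm_smul r g := by
    simp only [norm_def, smul_apply, ← mul_sub, abs_mul, mul_div_assoc, Real.norm_eq_abs]
    exact (Real.mul_iSup_of_nonneg (abs_nonneg r) _).symm
  norm_triangle g h := by
    refine norm_le_of_forall (add_nonneg (norm_nonneg' g) (norm_nonneg' h)) fun x y => ?_
    have e : (g + h) x - (g + h) y = (g x - g y) + (h x - h y) := by
      simp only [add_apply]; ring
    rw [e, add_mul]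
    exact (abs_add_le _ _).trans (add_le_add (g.abs_sub_le x y) (h.abs_sub_le x y))
  norm_eq_zero_iff g := by
    constructor
    · intro h
      refine DFunLike.ext _ _ fun x => ?_
      have := g.abs_apply_le x
      rw [h, mul_zero] at this
      simpa using this
    · rintro rfl
      simp [norm_def]

noncomputable instance : NormedAddCommGroup (LipZero c) :=
  NormedAddCommGroup.ofCore normedSpaceCore

noncomputable instance : NormedSpace ℝ (LipZero c) :=
  NormedSpace.ofCore normedSpaceCore

end LipZero

end LipZero

/-! ### The Lipschitz-free space -/

section Free

variable {M N : Type*} [MetricSpace M] [MetricSpace N]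

/-- The evaluation functional `⟨g, δ(x)⟩ = g(x)` on `Lip₀(M)`. -/
noncomputable def evalFunctional (c x : M) : StrongDual ℝ (LipZero c) :=
  LinearMap.mkContinuous
    { toFun := fun g => g x
      map_add' := fun _ _ => rfl
      map_smul' := fun _ _ => rfl } (dist x c) fun g => g.abs_apply_le x

@[simp] theorem evalFunctional_apply (c x : M) (g : LipZero c) : evalFunctional c x g = g x := rfl

/-- The norm-closed linear span of the evaluation functionals in `Lip₀(M)*`. -/
noncomputable def lipFreeSubmodule (c : M) : Submodule ℝ (StrongDual ℝ (LipZero c)) :=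
  (Submodule.span ℝ (Set.range (evalFunctional c))).topologicalClosure

/-- The Lipschitz-free space `𝓕(M)` of the metric space `M` with base point `c`, with the norm
of `Lip₀(M)*`. -/
abbrev LipFree (c : M) : Type _ := lipFreeSubmodule c

theorem evalFunctional_mem (c x : M) : evalFunctional c x ∈ lipFreeSubmodule c :=
  Submodule.le_topologicalClosure _ (Submodule.subset_span ⟨x, rfl⟩)

/-- The canonical map `δ : M → 𝓕(M)`. -/
noncomputable def lipFreeDelta (c x : M) : LipFree c :=
  ⟨evalFunctional c x, evalFunctional_mem c x⟩

/-- For a Lipschitz map `f : M → N` preserving base points, the bounded operator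
`Lip₀(N) → Lip₀(M)`, `g ↦ g ∘ f`. -/
noncomputable def lipZeroComp {c : M} {d : N} (f : M → N) (hf : ∃ K : ℝ≥0, LipschitzWith K f)
    (hc : f c = d) : LipZero d →L[ℝ] LipZero c :=
  LinearMap.mkContinuousOfExistsBound
    { toFun := fun g => (⟨fun x => g (f x), by
          refine ⟨show g (f c) = 0 by rw [hc]; exact g.apply_base, ?_⟩
          obtain ⟨K, hK⟩ := hf
          obtain ⟨L, hL⟩ := g.exists_lipschitzWith
          exact ⟨L * K, hL.comp hK⟩⟩ : lipZeroSubmodule c)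
      map_add' := fun _ _ => rfl
      map_smul' := fun _ _ => rfl } (by
    obtain ⟨K, hK⟩ := hf
    refine ⟨K, fun g => LipZero.norm_le_of_forall (mul_nonneg K.2 (norm_nonneg g)) fun x y => ?_⟩
    refine (g.abs_sub_le (f x) (f y)).trans ?_
    rw [mul_comm (K : ℝ), mul_assoc]
    exact mul_le_mul_of_nonneg_left (hK.dist_le_mul x y) (norm_nonneg g))

@[simp] theorem lipZeroComp_apply {c : M} {d : N} (f : M → N) (hf : ∃ K : ℝ≥0, LipschitzWith K f)
    (hc : f c = d) (g : LipZero d) (x : M) : lipZeroComp f hf hc g x = g (f x) := rfl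

/-- The transpose `Lip₀(M)* → Lip₀(N)*`, `φ ↦ φ ∘ (g ↦ g ∘ f)`. -/
noncomputable def lipDualMap {c : M} {d : N} (f : M → N) (hf : ∃ K : ℝ≥0, LipschitzWith K f)
    (hc : f c = d) : StrongDual ℝ (LipZero c) →L[ℝ] StrongDual ℝ (LipZero d) :=
  ContinuousLinearMap.precomp ℝ (lipZeroComp f hf hc)

theorem lipDualMap_evalFunctional {c : M} {d : N} (f : M → N)
    (hf : ∃ K : ℝ≥0, LipschitzWith K f) (hc : f c = d) (x : M) :
    lipDualMap f hf hc (evalFunctional c x) = evalFunctional d (f x) := rfl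

theorem lipDualMap_mem {c : M} {d : N} (f : M → N) (hf : ∃ K : ℝ≥0, LipschitzWith K f)
    (hc : f c = d) {φ : StrongDual ℝ (LipZero c)} (hφ : φ ∈ lipFreeSubmodule c) :
    lipDualMap f hf hc φ ∈ lipFreeSubmodule d := by
  have h : lipFreeSubmodule c ≤ (lipFreeSubmodule d).comap (lipDualMap f hf hc).toLinearMap := by
    refine Submodule.topologicalClosure_minimal _ ?_ ?_
    · rw [Submodule.span_le]
      rintro _ ⟨x, rfl⟩
      exact evalFunctional_mem d (f x)
    · exact (Submodule.isClosed_topologicalClosure _).preimage (lipDualMap f hf hc).continuous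
  exact h hφ

/-- The Lipschitz operator `f̂ : 𝓕(M) → 𝓕(N)` of a Lipschitz map `f : M → N` preserving base
points: the restriction of the transpose of `g ↦ g ∘ f`. By `lipOperator_unique` it is the only
bounded linear operator with `f̂(δ(x)) = δ(f(x))` for all `x`. -/
noncomputable def lipOperator {c : M} {d : N} (f : M → N) (hf : ∃ K : ℝ≥0, LipschitzWith K f)
    (hc : f c = d) : LipFree c →L[ℝ] LipFree d :=
  ((lipDualMap f hf hc).comp (lipFreeSubmodule c).subtypeL).codRestrict (lipFreeSubmodule d)
    fun φ => lipDualMap_mem f hf hc φ.2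

theorem lipOperator_delta {c : M} {d : N} (f : M → N) (hf : ∃ K : ℝ≥0, LipschitzWith K f)
    (hc : f c = d) (x : M) :
    lipOperator f hf hc (lipFreeDelta c x) = lipFreeDelta d (f x) := rfl

theorem lipOperator_unique {c : M} {d : N} (f : M → N) (hf : ∃ K : ℝ≥0, LipschitzWith K f)
    (hc : f c = d) (T : LipFree c →L[ℝ] LipFree d)
    (hT : ∀ x, T (lipFreeDelta c x) = lipFreeDelta d (f x)) : T = lipOperator f hf hc := by
  let S : Set (LipFree c) := {u | T u = lipOperator f hf hc u}
  have hS : IsClosed S := isClosed_eq T.continuous (lipOperator f hf hc).continuous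
  have hspan : ∀ φ (hφ : φ ∈ Submodule.span ℝ (Set.range (evalFunctional c))),
      (⟨φ, Submodule.le_topologicalClosure _ hφ⟩ : LipFree c) ∈ S := by
    intro φ hφ
    induction hφ using Submodule.span_induction with
    | mem φ h =>
      obtain ⟨x, rfl⟩ := h
      exact hT x
    | zero => exact (map_zero T).trans (map_zero _).symm
    | add φ ψ hφ hψ h₁ h₂ =>
      refine (map_add T ⟨φ, Submodule.le_topologicalClosure _ hφ⟩
        ⟨ψ, Submodule.le_topologicalClosure _ hψ⟩).trans ?_
      rw [h₁, h₂, ← map_add]; rfl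
    | smul r φ hφ h₁ =>
      refine (map_smul T r ⟨φ, Submodule.le_topologicalClosure _ hφ⟩).trans ?_
      rw [h₁, ← map_smul]; rfl
  ext1 u
  have hu : u ∈ closure S := by
    rw [Topology.IsInducing.subtypeVal.closure_eq_preimage_closure_image]
    have hsub : (Submodule.span ℝ (Set.range (evalFunctional c)) :
        Set (StrongDual ℝ (LipZero c))) ⊆ Subtype.val '' S :=
      fun φ hφ => ⟨_, hspan φ hφ, rfl⟩
    exact closure_mono hsub u.2
  rw [hS.closure_eq] at hu
  exact hu

end Free

/-!
In fact `f̂` is always mixing, whether or not `f` is: since the base point `c` is fixed by `f`, what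
matters is only how orbits of `f` travel to `c` and away from it.

*The interval.* For every neighbourhood `U` of `c`, every nonempty open `V` and all large `n`, the
set `fⁿ(V)` meets `U` (`IsTransitiveMap.eventually_to_fixed`) and `fⁿ(U)` meets `V`
(`IsTransitiveMap.eventually_from_fixed`). Transitivity supplies such times in every residue class
modulo any given `m`, because orbits linger near the fixed point `c`. The periodic points of a
transitive interval map are dense (`IsTransitiveMap.exists_periodic`). The sets `fⁿ(J)`, for `J` an
interval, are intervals, so they contain periodic points lying between `c` and points further
away; and a periodic point that has been reached is reached again after each period, which turns
one time in each residue class into all large times.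

*The operator.* The pairs `(u, w)` that are limits of pairs `(yₙ, f̂ⁿ yₙ)` form a closed subspace
(`graphLowerLimit`). By the facts about the interval it contains `(δ(x), δ(c)) = (δ(x), 0)` and
`(δ(c), δ(x)) = (0, δ(x))` for all `x`, so it is the whole of `𝓕 × 𝓕`, which says that `f̂` is
mixing.
-/

open Set Filter Topology

/-! ### Transitive maps and density of periodic points on an interval -/

section Transitive

variable {X : Type*} [TopologicalSpace X]

/-- A nonempty open set contains two disjoint nonempty open sets, and a passage from one to the
other takes at least one step. -/
theorem IsTransitiveMap.denseRange [T2Space X] [PerfectSpace X] {f : X → X}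
    (h : IsTransitiveMap f) : DenseRange f := by
  rw [DenseRange, dense_iff_inter_open]
  rintro V hV ⟨x, hx⟩
  obtain ⟨y, hyx, hy⟩ : ∃ y ∈ ({x}ᶜ : Set X), y ∈ V :=
    nonempty_of_mem (inter_mem self_mem_nhdsWithin (mem_nhdsWithin_of_mem_nhds (hV.mem_nhds hx)))
  obtain ⟨A, B, hA, hB, hyA, hxB, hAB⟩ := t2_separation hyx
  obtain ⟨n, z, ⟨w, hw, rfl⟩, hz⟩ := h (V ∩ A) (V ∩ B) (hV.inter hA) ⟨y, hy, hyA⟩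
    (hV.inter hB) ⟨x, hx, hxB⟩
  cases n with
  | zero => exact (disjoint_left.1 hAB hw.2 hz.2).elim
  | succ n =>
    rw [Function.iterate_succ_apply'] at hz
    exact ⟨_, hz.1, mem_range_self _⟩

/-- A transitive map of a Hausdorff space without isolated points visits every open set at
arbitrarily late times. -/
theorem IsTransitiveMap.exists_ge [T2Space X] [PerfectSpace X] {f : X → X}
    (h : IsTransitiveMap f) (hf : Continuous f) {U V : Set X} (hU : IsOpen U) (hUn : U.Nonempty)
    (hV : IsOpen V) (hVn : V.Nonempty) (N : ℕ) : ∃ n ≥ N, ∃ x ∈ U, f^[n] x ∈ V := by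
  have hd : DenseRange f^[N] := by
    induction N with
    | zero => exact denseRange_id
    | succ N ih => exact ih.comp h.denseRange (hf.iterate N)
  obtain ⟨_, hv, y, rfl⟩ := hd.inter_open_nonempty V hV hVn
  obtain ⟨n, _, ⟨x, hx, rfl⟩, hxV⟩ :=
    h U (f^[N] ⁻¹' V) hU hUn (hV.preimage (hf.iterate N)) ⟨y, hv⟩
  exact ⟨N + n, Nat.le_add_right _ _, x, hx, by rwa [Function.iterate_add_apply]⟩

/-- A property that persists after a step of length `m`, and holds somewhere in each residue class
modulo `m`, holds for all large numbers. -/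
theorem eventually_of_forall_modEq {P : ℕ → Prop} {m : ℕ} (hm : 0 < m)
    (hP : ∀ n, P n → P (n + m)) (h : ∀ i, ∃ n, n ≡ i [MOD m] ∧ P n) : ∀ᶠ n in atTop, P n := by
  choose n hn hPn using h
  refine eventually_atTop.2 ⟨(Finset.range m).sup n, fun k hk => ?_⟩
  have hle : n (k % m) ≤ k :=
    (Finset.le_sup (f := n) (Finset.mem_range.2 (Nat.mod_lt k hm))).trans hk
  obtain ⟨l, hl⟩ := (Nat.modEq_iff_dvd' hle).1 ((hn (k % m)).trans (Nat.mod_modEq k m))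
  have hadd : ∀ l, P (n (k % m) + m * l) := by
    intro l
    induction l with
    | zero => exact hPn _
    | succ l ih => rw [Nat.mul_succ, ← Nat.add_assoc]; exact hP _ ih
  rw [← Nat.add_sub_of_le hle, hl]
  exact hadd l

/-- The points that stay in a neighbourhood of a fixed point for a given time. -/
theorem isOpen_stay {f : X → X} (hf : Continuous f) {B : Set X} (hB : IsOpen B) (m : ℕ) :
    IsOpen {x | ∀ r < m, f^[r] x ∈ B} := by
  have e : {x | ∀ r < m, f^[r] x ∈ B} = ⋂ r ∈ Finset.range m, f^[r] ⁻¹' B := by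
    ext x; simp
  rw [e]
  exact isOpen_biInter_finset fun r _ => hB.preimage (hf.iterate r)

/-- Orbits from `J` come close to a fixed point at times of every residue class: they come so close
that they stay there for a full period. -/
theorem IsTransitiveMap.exists_modEq_to_fixed {f : X → X} (h : IsTransitiveMap f)
    (hf : Continuous f) {c : X} (hc : f c = c) {J B : Set X} (hJ : IsOpen J) (hJn : J.Nonempty)
    (hB : IsOpen B) (hcB : c ∈ B) {m : ℕ} (hm : 0 < m) (i : ℕ) :
    ∃ n, n ≡ i [MOD m] ∧ ∃ x ∈ J, f^[n] x ∈ B := by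
  obtain ⟨n, _, ⟨x, hx, rfl⟩, hxB⟩ := h J _ hJ hJn (isOpen_stay hf hB m)
    ⟨c, fun r _ => by rwa [Function.iterate_fixed hc]⟩
  refine ⟨(i + n * (m - 1)) % m + n, ?_, x, hx, ?_⟩
  · refine ((Nat.mod_modEq _ m).add_right n).trans ?_
    obtain ⟨m, rfl⟩ := Nat.exists_eq_add_of_le' hm
    have e : i + n * (m + 1 - 1) + n = i + (m + 1) * n := by
      rw [Nat.add_sub_cancel]; ring
    rw [e]
    simp [Nat.ModEq]
  · rw [Function.iterate_add_apply]
    exact hxB _ (Nat.mod_lt _ hm)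

/-- Orbits starting near a fixed point reach every open set at times of every residue class: they
may be started later, after having stayed near the fixed point for less than a full period. -/
theorem IsTransitiveMap.exists_modEq_from_fixed [T2Space X] [PerfectSpace X] {f : X → X}
    (h : IsTransitiveMap f) (hf : Continuous f) {c : X} (hc : f c = c) {J B : Set X}
    (hJ : IsOpen J) (hJn : J.Nonempty) (hB : IsOpen B) (hcB : c ∈ B) {m : ℕ} (hm : 0 < m)
    (i : ℕ) : ∃ n, n ≡ i [MOD m] ∧ ∃ x ∈ B, f^[n] x ∈ J := by
  obtain ⟨n, hn, x, hx, hxJ⟩ := h.exists_ge hf (isOpen_stay hf hB m)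
    ⟨c, fun r _ => by rwa [Function.iterate_fixed hc]⟩ hJ hJn m
  set r := (n + i * (m - 1)) % m with hr
  have hrm : r < m := Nat.mod_lt _ hm
  have e : n - r + r = n := Nat.sub_add_cancel (hrm.le.trans hn)
  refine ⟨n - r, ?_, f^[r] x, hx r hrm, by rwa [← Function.iterate_add_apply, e]⟩
  refine Nat.ModEq.add_right_cancel' r ?_
  rw [e]
  refine Nat.ModEq.symm (((Nat.mod_modEq _ m).add_left i).trans ?_)
  obtain ⟨m, rfl⟩ := Nat.exists_eq_add_of_le' hm
  have e : i + (n + i * (m + 1 - 1)) = n + (m + 1) * i := by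
    rw [Nat.add_sub_cancel]; ring
  rw [e]
  simp [Nat.ModEq]

omit [TopologicalSpace X] in
theorem mem_image_iterate_add {f : X → X} {J : Set X} {q : X} {m n : ℕ} (hq : f^[m] q = q)
    (h : q ∈ f^[n] '' J) : q ∈ f^[n + m] '' J := by
  obtain ⟨x, hx, e⟩ := h
  exact ⟨x, hx, by rw [add_comm, Function.iterate_add_apply, e, hq]⟩

omit [TopologicalSpace X] in
theorem iterate_of_dvd {f : X → X} {q : X} {k m : ℕ} (hq : f^[k] q = q) (h : k ∣ m) :
    f^[m] q = q := by
  obtain ⟨l, rfl⟩ := h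
  rw [Function.iterate_mul]
  exact Function.iterate_fixed hq l

omit [TopologicalSpace X] in
theorem iterate_modEq {f : X → X} {p : X} {m n i : ℕ} (hp : f^[m] p = p) (h : n ≡ i [MOD m]) :
    f^[n] p = f^[i] p := by
  have key : ∀ n, f^[n] p = f^[n % m] p := fun n => by
    conv_lhs => rw [← Nat.mod_add_div n m, Function.iterate_add_apply,
      iterate_of_dvd hp (dvd_mul_right m _)]
  rw [key n, key i, h]

end Transitive

section Interval

variable {X : Type*} [CompleteLinearOrder X] [TopologicalSpace X] [OrderTopology X]
  [DenselyOrdered X]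

theorem exists_mem_Icc_fixed {g : X → X} (hg : Continuous g) {x y : X} (hxy : x ≤ y)
    (hx : x ≤ g x) (hy : g y ≤ y) : ∃ z ∈ Icc x y, g z = z := by
  obtain ⟨z, hz, e⟩ := isPreconnected_Icc.intermediate_value₂ (left_mem_Icc.2 hxy)
    (right_mem_Icc.2 hxy) continuous_id.continuousOn hg.continuousOn hx hy
  exact ⟨z, hz, e.symm⟩

/-- If an interval contains `x < g x` and no periodic point of `g`, then `x` stays below all its
iterates: otherwise some `g^k` would move `x` to the right and `g x` to the left. -/
theorem lt_iterate_of_no_periodic {g : X → X} (hg : Continuous g) {x : X} (hx : x < g x)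
    (hno : ∀ z ∈ Icc x (g x), ∀ k, 0 < k → g^[k] z ≠ z) (k : ℕ) (hk : 0 < k) : x < g^[k] x := by
  induction k, hk using Nat.le_induction with
  | base => exact hx
  | succ k hk ih =>
    by_contra! hle
    rw [Function.iterate_succ_apply] at hle
    obtain ⟨z, hz, e⟩ := exists_mem_Icc_fixed (hg.iterate k) hx.le
      ih.le (hle.trans hx.le)
    exact hno z hz k hk e

/-- The mirror image of `lt_iterate_of_no_periodic`. -/
theorem iterate_lt_of_no_periodic {g : X → X} (hg : Continuous g) {x : X} (hx : g x < x)
    (hno : ∀ z ∈ Icc (g x) x, ∀ k, 0 < k → g^[k] z ≠ z) (k : ℕ) (hk : 0 < k) : g^[k] x < x := by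
  induction k, hk using Nat.le_induction with
  | base => exact hx
  | succ k hk ih =>
    by_contra! hle
    rw [Function.iterate_succ_apply] at hle
    obtain ⟨z, hz, e⟩ := exists_mem_Icc_fixed (hg.iterate k) hx.le
      (hx.le.trans hle) ih.le
    exact hno z hz k hk e

/-- An orbit cannot move to the right and later back to the left inside an interval without
periodic points. -/
theorem exists_periodic_of_turn {f : X → X} (hf : Continuous f) {J : Set X} (hJ : J.OrdConnected)
    {x : X} {m l : ℕ} (hm : 0 < m) (hl : 0 < l) (hx : x ∈ J) (hxm : f^[m] x ∈ J)
    (hxl : f^[l] (f^[m] x) ∈ J) (h1 : x < f^[m] x) (h2 : f^[l] (f^[m] x) < f^[m] x) :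
    ∃ z ∈ J, ∃ k, 0 < k ∧ f^[k] z = z := by
  by_contra! hno
  -- `f^(m * l)` moves `x` to the right and `f^m x` to the left, so it has a fixed point in between
  have h1' : x < (f^[m])^[l] x := lt_iterate_of_no_periodic (hf.iterate m) h1
    (fun z hz k hk => by
      rw [← Function.iterate_mul]
      exact hno z (hJ.out hx hxm hz) _ (Nat.mul_pos hm hk)) l hl
  have h2' : (f^[l])^[m] (f^[m] x) < f^[m] x := iterate_lt_of_no_periodic (hf.iterate l) h2
    (fun z hz k hk => by
      rw [← Function.iterate_mul]
      exact hno z (hJ.out hxl hxm hz) _ (Nat.mul_pos hl hk)) m hm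
  rw [← Function.iterate_mul] at h1' h2'
  rw [mul_comm] at h2'
  obtain ⟨z, hz, e⟩ := exists_mem_Icc_fixed (hf.iterate (m * l)) h1.le h1'.le h2'.le
  exact hno z (hJ.out hx hxm hz) _ (Nat.mul_pos hm hl) e

/-- A convex image of `J` contains every point lying between two of its points. -/
theorem mem_image_iterate_of_between {f : X → X} (hf : Continuous f) {J : Set X}
    (hJ : J.OrdConnected) {n : ℕ} {x y q : X} (hx : x ∈ J) (hy : y ∈ J) (h1 : f^[n] x ≤ q)
    (h2 : q ≤ f^[n] y) : q ∈ f^[n] '' J :=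
  (hJ.isPreconnected.image _ (hf.iterate n).continuousOn).ordConnected.out
    (mem_image_of_mem _ hx) (mem_image_of_mem _ hy) ⟨h1, h2⟩

omit [DenselyOrdered X] in
theorem exists_isOpen_ordConnected {U : Set X} (hU : IsOpen U) {c : X} (hc : c ∈ U) :
    ∃ J ⊆ U, IsOpen J ∧ c ∈ J ∧ J.OrdConnected := by
  refine ⟨ordConnectedComponent U c, ordConnectedComponent_subset, ?_,
    self_mem_ordConnectedComponent.2 hc, inferInstance⟩
  refine isOpen_iff_mem_nhds.2 fun x hx => ?_
  rw [ordConnectedComponent_eq hx, ordConnectedComponent_mem_nhds]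
  exact hU.mem_nhds (ordConnectedComponent_subset hx)

variable [Nontrivial X]

/-- The periodic points of a transitive continuous interval map are dense. -/
theorem IsTransitiveMap.exists_periodic {f : X → X} (h : IsTransitiveMap f) (hf : Continuous f)
    {V : Set X} (hV : IsOpen V) (hVn : V.Nonempty) : ∃ z ∈ V, ∃ k, 0 < k ∧ f^[k] z = z := by
  have : ConnectedSpace X := { toNonempty := inferInstance }
  obtain ⟨s, t, hst, hsub⟩ := hV.exists_Ioo_subset hVn
  obtain ⟨r, hsr, hrt⟩ := exists_between hst
  -- an orbit passes from `(s, r)` to `(r, t)` at time `m` and is back in `(s, r)` at time `n > m`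
  obtain ⟨m, hm, x, hx, hxm⟩ := h.exists_ge hf isOpen_Ioo (nonempty_Ioo.2 hsr) isOpen_Ioo
    (nonempty_Ioo.2 hrt) 1
  obtain ⟨n, hn, y, ⟨hy, hym⟩, hyn⟩ := h.exists_ge hf
    ((isOpen_Ioo (a := s) (b := r)).inter
      ((isOpen_Ioo (a := r) (b := t)).preimage (hf.iterate m))) ⟨x, hx, hxm⟩ isOpen_Ioo
    (nonempty_Ioo.2 hsr) (m + 1)
  obtain ⟨l, rfl⟩ := Nat.exists_eq_add_of_le' hn
  have e : l + (m + 1) = (l + 1) + m := by omega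
  rw [e, Function.iterate_add_apply] at hyn
  have hz := exists_periodic_of_turn hf (ordConnected_Ioo (a := s) (b := t)) hm l.succ_pos
    ⟨hy.1, hy.2.trans hrt⟩ ⟨hsr.trans hym.1, hym.2⟩ ⟨hyn.1, hyn.2.trans hrt⟩
    (hy.2.trans hym.1) (hyn.2.trans hym.1)
  obtain ⟨z, hz, k⟩ := hz
  exact ⟨z, hsub hz, k⟩

/-! ### Hitting times to and from a fixed point -/


/-- Every neighbourhood of a fixed point eventually reaches any given open set. A periodic point `q`
of that set, not an endpoint, lies between the fixed point and some point of `f^n(U)`, for some `n`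
in each residue class modulo the period of `q`; and once `q` is reached, it is reached again after
each period. -/
theorem IsTransitiveMap.eventually_from_fixed {f : X → X} (h : IsTransitiveMap f)
    (hf : Continuous f) {c : X} (hc : f c = c) {U V : Set X} (hU : IsOpen U) (hcU : c ∈ U)
    (hV : IsOpen V) (hVn : V.Nonempty) : ∀ᶠ n in atTop, ∃ x ∈ U, f^[n] x ∈ V := by
  have : ConnectedSpace X := { toNonempty := inferInstance }
  obtain ⟨J, hJU, hJ, hcJ, hJc⟩ := exists_isOpen_ordConnected hU hcU
  obtain ⟨s, t, hst, hsub⟩ := hV.exists_Ioo_subset hVn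
  obtain ⟨q, ⟨hsq, hqt⟩, m, hm, hq⟩ := h.exists_periodic hf isOpen_Ioo (nonempty_Ioo.2 hst)
  suffices H : ∀ᶠ n in atTop, q ∈ f^[n] '' J from H.mono fun n ⟨x, hx, e⟩ =>
    ⟨x, hJU hx, hsub (e ▸ ⟨hsq, hqt⟩)⟩
  refine eventually_of_forall_modEq hm (fun n => mem_image_iterate_add hq) fun i => ?_
  rcases le_total q c with hqc | hqc
  · obtain ⟨n, hn, x, hx, hxq⟩ := h.exists_modEq_from_fixed hf hc (isOpen_Iio (a := q)) ⟨s, hsq⟩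
      hJ hcJ hm i
    exact ⟨n, hn, mem_image_iterate_of_between hf hJc hx hcJ hxq.le
      (by rwa [Function.iterate_fixed hc])⟩
  · obtain ⟨n, hn, x, hx, hxq⟩ := h.exists_modEq_from_fixed hf hc (isOpen_Ioi (a := q)) ⟨t, hqt⟩
      hJ hcJ hm i
    exact ⟨n, hn, mem_image_iterate_of_between hf hJc hcJ hx
      (by rwa [Function.iterate_fixed hc]) hxq.le⟩

/-- Any open set eventually reaches every neighbourhood of a fixed point `c`. It contains a periodic
point `p`; choose periodic points `q₁ < c < q₂` in the neighbourhood. For each residue class modulo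
a common period, the corresponding iterate of `p` is either in the neighbourhood, or separated from
`c` by `q₁` or `q₂`, which is then reached. If `c` is an endpoint then `q₁` or `q₂` is `c`. -/
theorem IsTransitiveMap.eventually_to_fixed {f : X → X} (h : IsTransitiveMap f)
    (hf : Continuous f) {c : X} (hc : f c = c) {U V : Set X} (hU : IsOpen U) (hcU : c ∈ U)
    (hV : IsOpen V) (hVn : V.Nonempty) : ∀ᶠ n in atTop, ∃ x ∈ V, f^[n] x ∈ U := by
  have : ConnectedSpace X := { toNonempty := inferInstance }
  obtain ⟨B, hBU, hB, hcB, hBc⟩ := exists_isOpen_ordConnected hU hcU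
  obtain ⟨p, hpV, k, hk, hp⟩ := h.exists_periodic hf hV hVn
  obtain ⟨J, hJV, hJ, hpJ, hJc⟩ := exists_isOpen_ordConnected hV hpV
  obtain ⟨q₁, hq₁B, hq₁c, k₁, hk₁, hq₁⟩ : ∃ q ∈ B, (∀ x < c, q < c) ∧ ∃ k, 0 < k ∧
      f^[k] q = q := by
    by_cases hbot : ∃ x, x < c
    · obtain ⟨x, hx⟩ := hbot
      obtain ⟨s, hs, hsB⟩ := exists_Ioc_subset_of_mem_nhds (hB.mem_nhds hcB) ⟨x, hx⟩
      obtain ⟨q, hq, k⟩ := h.exists_periodic hf isOpen_Ioo (nonempty_Ioo.2 hs)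
      exact ⟨q, hsB ⟨hq.1, hq.2.le⟩, fun _ _ => hq.2, k⟩
    · exact ⟨c, hcB, fun x hx => (hbot ⟨x, hx⟩).elim, 1, one_pos, hc⟩
  obtain ⟨q₂, hq₂B, hq₂c, k₂, hk₂, hq₂⟩ : ∃ q ∈ B, (∀ x, c < x → c < q) ∧ ∃ k, 0 < k ∧
      f^[k] q = q := by
    by_cases htop : ∃ x, c < x
    · obtain ⟨x, hx⟩ := htop
      obtain ⟨s, hs, hsB⟩ := exists_Ico_subset_of_mem_nhds (hB.mem_nhds hcB) ⟨x, hx⟩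
      obtain ⟨q, hq, k⟩ := h.exists_periodic hf isOpen_Ioo (nonempty_Ioo.2 hs)
      exact ⟨q, hsB ⟨hq.1.le, hq.2⟩, fun _ _ => hq.1, k⟩
    · exact ⟨c, hcB, fun x hx => (htop ⟨x, hx⟩).elim, 1, one_pos, hc⟩
  have hm : 0 < k * k₁ * k₂ := by positivity
  have hp' := iterate_of_dvd hp (Dvd.intro _ (mul_assoc k k₁ k₂).symm)
  have hq₁' := iterate_of_dvd hq₁ (Dvd.intro_left k rfl |>.mul_right k₂)
  have hq₂' := iterate_of_dvd hq₂ (Dvd.intro_left (k * k₁) rfl)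
  set m := k * k₁ * k₂
  suffices H : ∀ᶠ n in atTop, f^[n] p ∈ B ∨ q₁ ∈ f^[n] '' J ∨ q₂ ∈ f^[n] '' J by
    refine H.mono fun n hn => ?_
    rcases hn with hn | ⟨x, hx, e⟩ | ⟨x, hx, e⟩
    · exact ⟨p, hpV, hBU hn⟩
    · exact ⟨x, hJV hx, hBU (e ▸ hq₁B)⟩
    · exact ⟨x, hJV hx, hBU (e ▸ hq₂B)⟩
  refine eventually_of_forall_modEq hm (fun n hn => ?_) fun i => ?_
  · refine hn.imp (fun hn => ?_) (Or.imp (mem_image_iterate_add hq₁') (mem_image_iterate_add hq₂'))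
    rwa [Function.iterate_add_apply, hp']
  by_cases hi : f^[i] p ∈ B
  · exact ⟨i, rfl, Or.inl hi⟩
  rcases lt_trichotomy (f^[i] p) c with hlt | heq | hlt
  · obtain ⟨n, hn, x, hx, hxq⟩ := h.exists_modEq_to_fixed hf hc hJ ⟨p, hpJ⟩
      (isOpen_Ioi (a := q₁)) (hq₁c _ hlt) hm i
    have hle : f^[i] p ≤ q₁ := by
      by_contra! hcon
      exact hi (hBc.out hq₁B hcB ⟨hcon.le, hlt.le⟩)
    exact ⟨n, hn, Or.inr <| Or.inl <| mem_image_iterate_of_between hf hJc hpJ hx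
      (iterate_modEq hp' hn ▸ hle) (le_of_lt hxq)⟩
  · exact (hi (heq ▸ hcB)).elim
  · obtain ⟨n, hn, x, hx, hxq⟩ := h.exists_modEq_to_fixed hf hc hJ ⟨p, hpJ⟩
      (isOpen_Iio (a := q₂)) (hq₂c _ hlt) hm i
    have hle : q₂ ≤ f^[i] p := by
      by_contra! hcon
      exact hi (hBc.out hcB hq₂B ⟨hlt.le, hcon.le⟩)
    exact ⟨n, hn, Or.inr <| Or.inr <| mem_image_iterate_of_between hf hJc hx hpJ
      (le_of_lt hxq) (iterate_modEq hp' hn ▸ hle)⟩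

end Interval

/-! ### A mixing criterion for linear operators -/

theorem IsMixingMap.isWeaklyMixingMap {X : Type*} [TopologicalSpace X] {T : X → X}
    (h : IsMixingMap T) : IsWeaklyMixingMap T := by
  rintro U V hU ⟨⟨u, u'⟩, hu⟩ hV ⟨⟨v, v'⟩, hv⟩
  obtain ⟨A, A', hA, hA', huA, huA', hAU⟩ := isOpen_prod_iff.1 hU u u' hu
  obtain ⟨B, B', hB, hB', hvB, hvB', hBV⟩ := isOpen_prod_iff.1 hV v v' hv
  obtain ⟨N, hN⟩ := h A B hA ⟨u, huA⟩ hB ⟨v, hvB⟩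
  obtain ⟨N', hN'⟩ := h A' B' hA' ⟨u', huA'⟩ hB' ⟨v', hvB'⟩
  obtain ⟨_, ⟨x, hx, rfl⟩, hxB⟩ := hN (max N N') (le_max_left _ _)
  obtain ⟨_, ⟨x', hx', rfl⟩, hxB'⟩ := hN' (max N N') (le_max_right _ _)
  refine ⟨max N N', _, ⟨(x, x'), hAU ⟨hx, hx'⟩, rfl⟩, ?_⟩
  rw [Prod.map_iterate]
  exact hBV ⟨hxB, hxB'⟩

section LowerLimit

variable {F : Type*} [AddCommMonoid F] [Module ℝ F] [TopologicalSpace F] [ContinuousAdd F]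
  [ContinuousConstSMul ℝ F]

/-- The lower limit of the graphs of the powers of `T`: the pairs `(u, w)` that are approximated by
pairs `(y, Tⁿ y)` for all large `n`. -/
def graphLowerLimit (T : F →L[ℝ] F) : Submodule ℝ (F × F) where
  carrier := {z | ∀ O ∈ 𝓝 z, ∀ᶠ n in atTop, ∃ y, (y, T^[n] y) ∈ O}
  zero_mem' := fun O hO => .of_forall fun n => ⟨0, by
    rw [iterate_map_zero]; exact mem_of_mem_nhds hO⟩
  add_mem' := by
    intro z w hz hw O hO
    obtain ⟨A, hA, B, hB, hAB⟩ := mem_nhds_prod_iff.1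
      ((continuous_add (M := F × F)).continuousAt (x := (z, w)) hO)
    filter_upwards [hz A hA, hw B hB] with n ⟨x, hx⟩ ⟨y, hy⟩
    refine ⟨x + y, ?_⟩
    rw [iterate_map_add]
    exact hAB (mk_mem_prod hx hy)
  smul_mem' := by
    intro r z hz O hO
    filter_upwards [hz _ ((continuous_const_smul r).continuousAt (x := z) hO)] with n ⟨x, hx⟩
    refine ⟨r • x, ?_⟩
    rw [(Function.Commute.iterate_left (f := T) (g := (r • ·)) (fun y => map_smul T r y) n).eq x]
    exact hx

theorem isClosed_graphLowerLimit (T : F →L[ℝ] F) :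
    IsClosed (graphLowerLimit T : Set (F × F)) := by
  refine isClosed_of_closure_subset fun z hz O hO => ?_
  obtain ⟨O', hO'O, hO', hzO'⟩ := mem_nhds_iff.1 hO
  obtain ⟨w, hwO', hw⟩ := mem_closure_iff.1 hz O' hO' hzO'
  exact (hw O' (hO'.mem_nhds hwO')).mono fun n ⟨y, hy⟩ => ⟨y, hO'O hy⟩

theorem isMixingMap_of_graphLowerLimit {T : F →L[ℝ] F} (h : graphLowerLimit T = ⊤) :
    IsMixingMap T := by
  rintro U V hU ⟨u, hu⟩ hV ⟨v, hv⟩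
  have huv : (u, v) ∈ graphLowerLimit T := h ▸ Submodule.mem_top
  obtain ⟨N, hN⟩ := eventually_atTop.1
    (huv _ (prod_mem_nhds (hU.mem_nhds hu) (hV.mem_nhds hv)))
  refine ⟨N, fun n hn => ?_⟩
  obtain ⟨y, hyU, hyV⟩ := hN n hn
  exact ⟨_, ⟨y, hyU, rfl⟩, hyV⟩

end LowerLimit

/-! ### Lipschitz-free spaces -/

section LipFree

variable {M : Type*} [MetricSpace M] {c : M}

instance (c : M) : ContinuousAdd (LipFree c) :=
  ⟨((continuous_subtype_val.comp continuous_fst).add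
    (continuous_subtype_val.comp continuous_snd)).subtype_mk _⟩

instance (c : M) : ContinuousConstSMul ℝ (LipFree c) :=
  ⟨fun r => (continuous_subtype_val.const_smul r).subtype_mk _⟩

theorem lipFreeDelta_base (c : M) : lipFreeDelta c c = 0 := by
  ext g
  exact g.apply_base

theorem continuous_lipFreeDelta (c : M) : Continuous (lipFreeDelta c) := by
  refine (LipschitzWith.of_dist_le_mul (K := 1) fun x y => ?_).continuous
  rw [NNReal.coe_one, one_mul, Subtype.dist_eq, dist_eq_norm]
  refine ContinuousLinearMap.opNorm_le_bound _ dist_nonneg fun g => ?_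
  rw [mul_comm]
  exact g.abs_sub_le x y

/-- The evaluation functionals are total in the Lipschitz-free space. -/
theorem eq_top_of_lipFreeDelta_mem {S : Submodule ℝ (LipFree c)}
    (hS : IsClosed (S : Set (LipFree c))) (h : ∀ x, lipFreeDelta c x ∈ S) : S = ⊤ := by
  rw [eq_top_iff]
  rintro u -
  have hspan : Submodule.span ℝ (range (evalFunctional c)) ≤
      S.map (lipFreeSubmodule c).subtype := by
    rw [Submodule.span_le]
    rintro _ ⟨x, rfl⟩
    exact ⟨_, h x, rfl⟩
  have hu : u ∈ closure (S : Set (LipFree c)) := by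
    rw [Topology.IsInducing.subtypeVal.closure_eq_preimage_closure_image]
    exact closure_mono hspan u.2
  rwa [hS.closure_eq] at hu

theorem iterate_lipOperator_delta {f : M → M} (hf : ∃ K : ℝ≥0, LipschitzWith K f) (hc : f c = c)
    (n : ℕ) (x : M) :
    (lipOperator f hf hc)^[n] (lipFreeDelta c x) = lipFreeDelta c (f^[n] x) := by
  induction n generalizing x with
  | zero => rfl
  | succ n ih => rw [Function.iterate_succ_apply, lipOperator_delta, ih, Function.iterate_succ_apply]

theorem lipFreeDelta_mem_graphLowerLimit {f : M → M} (hf : ∃ K : ℝ≥0, LipschitzWith K f)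
    (hc : f c = c) {x y : M} (h : ∀ U V : Set M, IsOpen U → x ∈ U → IsOpen V → y ∈ V →
      ∀ᶠ n in atTop, ∃ z ∈ U, f^[n] z ∈ V) :
    (lipFreeDelta c x, lipFreeDelta c y) ∈ graphLowerLimit (lipOperator f hf hc) := by
  intro O hO
  obtain ⟨A, hA, B, hB, hAB⟩ := mem_nhds_prod_iff.1 hO
  obtain ⟨U, hUA, hU, hxU⟩ := mem_nhds_iff.1 ((continuous_lipFreeDelta c).continuousAt hA)
  obtain ⟨V, hVB, hV, hyV⟩ := mem_nhds_iff.1 ((continuous_lipFreeDelta c).continuousAt hB)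
  filter_upwards [h U V hU hxU hV hyV] with n ⟨z, hz, hzV⟩
  refine ⟨lipFreeDelta c z, hAB ⟨hUA hz, ?_⟩⟩
  rw [iterate_lipOperator_delta]
  exact hVB hzV

/-- `f̂` is mixing as soon as, for all large `n`, the map `fⁿ` sends points of any given open set
close to the base point, and points close to the base point into any given open set. -/
theorem isMixingMap_lipOperator {f : M → M} (hf : ∃ K : ℝ≥0, LipschitzWith K f) (hc : f c = c)
    (hto : ∀ U V : Set M, IsOpen U → c ∈ U → IsOpen V → V.Nonempty →
      ∀ᶠ n in atTop, ∃ x ∈ V, f^[n] x ∈ U)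
    (hfrom : ∀ U V : Set M, IsOpen U → c ∈ U → IsOpen V → V.Nonempty →
      ∀ᶠ n in atTop, ∃ x ∈ U, f^[n] x ∈ V) :
    IsMixingMap (lipOperator f hf hc) := by
  refine isMixingMap_of_graphLowerLimit (F := LipFree c) (T := lipOperator f hf hc) ?_
  have hclosed := isClosed_graphLowerLimit (lipOperator f hf hc)
  have h1 : (graphLowerLimit (lipOperator f hf hc)).comap
      (LinearMap.inl ℝ (LipFree c) (LipFree c)) = ⊤ := by
    refine eq_top_of_lipFreeDelta_mem (hclosed.preimage (Continuous.prodMk_left 0)) fun x => ?_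
    have := lipFreeDelta_mem_graphLowerLimit hf hc (x := x) (y := c)
      fun U V hU hx hV hcV => hto V U hV hcV hU ⟨x, hx⟩
    rwa [lipFreeDelta_base] at this
  have h2 : (graphLowerLimit (lipOperator f hf hc)).comap
      (LinearMap.inr ℝ (LipFree c) (LipFree c)) = ⊤ := by
    refine eq_top_of_lipFreeDelta_mem (hclosed.preimage (Continuous.prodMk_right 0)) fun y => ?_
    have := lipFreeDelta_mem_graphLowerLimit hf hc (x := c) (y := y)
      fun U V hU hcU hV hy => hfrom U V hU hcU hV ⟨y, hy⟩
    rwa [lipFreeDelta_base] at this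
  rw [eq_top_iff]
  rintro ⟨u, w⟩ -
  have hu : (u, 0) ∈ graphLowerLimit (lipOperator f hf hc) :=
    Submodule.mem_comap.1 (h1 ▸ Submodule.mem_top)
  have hw : (0, w) ∈ graphLowerLimit (lipOperator f hf hc) :=
    Submodule.mem_comap.1 (h2 ▸ Submodule.mem_top)
  simpa using add_mem hu hw

end LipFree

theorem theorem4p1 (a b : ℝ) (hab : a < b) (f : Set.Icc a b → Set.Icc a b)
    (hf : ∃ K : ℝ≥0, LipschitzWith K f) (htrans : IsTransitiveMap f)
    (c : Set.Icc a b) (hc : f c = c) :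
    IsWeaklyMixingMap (lipOperator (c := c) (d := c) f hf hc) ∧
      ((∃ p q : Set.Icc a b, p ≠ q ∧ f p = p ∧ f q = q) →
        IsMixingMap (lipOperator (c := c) (d := c) f hf hc)) := by
  have : Fact (a ≤ b) := ⟨hab.le⟩
  have : Nontrivial (Set.Icc a b) := ⟨⟨a, left_mem_Icc.2 hab.le⟩, ⟨b, right_mem_Icc.2 hab.le⟩,
    fun h => hab.ne (congrArg Subtype.val h)⟩
  have hcont : Continuous f := hf.choose_spec.continuous
  have hmix : IsMixingMap (lipOperator (c := c) (d := c) f hf hc) :=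
    isMixingMap_lipOperator hf hc
      (fun U V hU hcU hV hVn => htrans.eventually_to_fixed hcont hc hU hcU hV hVn)
      (fun U V hU hcU hV hVn => htrans.eventually_from_fixed hcont hc hU hcU hV hVn)
  exact ⟨hmix.isWeaklyMixingMap, fun _ => hmix⟩
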